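/- Let $n\ge 1$ and let $$P=\begin{bmatrix}\theta_0&\lambda_0\\ \mu_1&\theta_1&\lambda_1\\ &\ddots&\ddots&\ddots\\ &&\mu_{n-2}&\theta_{n-2}&\lambda_{n-2}\\ &&&\mu_{n-1}&\theta_{n-1}\end{bmatrix}\in\mathbb R^{n\times n}$$ be a tridiagonal matrix (rows and columns numbered $0,\dots,n-1$) that is stochastic (nonnegative entries, row sums $1$) and irreducible. Let $\mathbf 1$ be the all-ones vector. For every $v\in\mathbb R^n$ with $v^\top\mathbf 1=1$ the matrix $I-P+\mathbf 1v^\top$ is invertible, and Kemeny's constant of $P$ is $$\kappa(P)=\operatorname{trace}\bigl((I-P+\mathbf 1v^\top)^{-1}\bigr)-1,$$ whose value does not depend on the choice of $v$. With empty products equal to $1$, put $$t(k)=\prod_{\ell=0}^{k-1}\lambda_\ell\prod_{\ell=k+1}^{n-1}\mu_\ell\qquad(0\le k\le n-1),$$ $$w(j,k,p)=\prod_{\ell=0}^{j-1}\lambda_\ell\prod_{\ell=j+1}^{p}\mu_\ell\prod_{\ell=p+1}^{k-1}\lambda_\ell\prod_{\ell=k+1}^{n-1}\mu_\ell\qquad(0\le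 j\le p<k\le n-1).$$ Then $\sum_{k=0}^{n-1}t(k)>0$ and $$\kappa(P)=\frac{\sum_{0\le j<k\le n-1}\sum_{p=j}^{k-1}w(j,k,p)}{\sum_{k=0}^{n-1}t(k)}.$$ Moreover, there is a unique vector $\pi=(\pi_0,\dots,\pi_{n-1})$ with $\pi^\top P=\pi^\top$ and $\pi^\top\mathbf 1=1$; its entries are positive, and with $\sigma_k=\sum_{j=0}^k\pi_j$, $$\kappa(P)=\sum_{k=0}^{n-2}\frac{\sigma_k(1-\sigma_k)}{\lambda_k\pi_k}.$$ Explicitly, $$\pi_0=\Bigl(\sum_{j=0}^{n-1}\frac{\prod_{\ell=0}^{j-1}\lambda_\ell}{\prod_{\ell=1}^{j}\mu_\ell}\Bigr)^{-1},\qquad \pi_j=\pi_0\,\frac{\prod_{\ell=0}^{j-1}\lambda_\ell}{\prod_{\ell=1}^{j}\mu_\ell}\quad(j=1,\dots,n-1).$$ -/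

import Mathlib

open scoped Matrix

/-- The `n × n` tridiagonal matrix, with rows and columns numbered `0, …, n - 1`, whose row `i` has
diagonal entry `theta i`, superdiagonal entry `lam i` (at column `i + 1`) and subdiagonal entry
`mu i` (at column `i - 1`). Only `theta i` with `i < n`, `lam i` with `i + 1 < n` and `mu i` with
`1 ≤ i < n` are used. -/
def birthDeathMatrix (n : ℕ) (theta lam mu : ℕ → ℝ) : Matrix (Fin n) (Fin n) ℝ :=
  Matrix.of fun i j =>
    if (j : ℕ) = (i : ℕ) then theta i
    else if (j : ℕ) = (i : ℕ) + 1 then lam i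
    else if (i : ℕ) = (j : ℕ) + 1 then mu i
    else 0

/-- The matrix `I - P + 𝟏 vᵀ`. -/
def kemenyMatrix {n : ℕ} (P : Matrix (Fin n) (Fin n) ℝ) (v : Fin n → ℝ) :
    Matrix (Fin n) (Fin n) ℝ :=
  1 - P + Matrix.vecMulVec 1 v

/-- Kemeny's constant `κ(P) = trace ((I - P + 𝟏 vᵀ)⁻¹) - 1`, where `v` is any vector whose entries
sum to one; for an irreducible stochastic matrix `P` the value does not depend on `v`. -/
noncomputable def kemenyConstant {n : ℕ} (P : Matrix (Fin n) (Fin n) ℝ) (v : Fin n → ℝ) : ℝ :=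
  (kemenyMatrix P v)⁻¹.trace - 1

/-- `t(k)`, the product of `lam ℓ` for `0 ≤ ℓ ≤ k - 1` and of `mu ℓ` for `k + 1 ≤ ℓ ≤ n - 1`. -/
noncomputable def treeWeight (n : ℕ) (lam mu : ℕ → ℝ) (k : ℕ) : ℝ :=
  (∏ l ∈ Finset.Ico 0 k, lam l) * ∏ l ∈ Finset.Ico (k + 1) n, mu l

/-- `w(j,k,p)`, the product of `lam ℓ` for `0 ≤ ℓ ≤ j - 1`, of `mu ℓ` for `j + 1 ≤ ℓ ≤ p`, of
`lam ℓ` for `p + 1 ≤ ℓ ≤ k - 1` and of `mu ℓ` for `k + 1 ≤ ℓ ≤ n - 1`. -/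
noncomputable def forestWeight (n : ℕ) (lam mu : ℕ → ℝ) (j k p : ℕ) : ℝ :=
  (∏ l ∈ Finset.Ico 0 j, lam l) * (∏ l ∈ Finset.Icc (j + 1) p, mu l) *
    (∏ l ∈ Finset.Ico (p + 1) k, lam l) * ∏ l ∈ Finset.Ico (k + 1) n, mu l

/-- `π` is a left fixed vector of `P` whose entries sum to one. -/
def IsStationaryVector {n : ℕ} (P : Matrix (Fin n) (Fin n) ℝ) (pi : Fin n → ℝ) : Prop :=
  pi ᵥ* P = pi ∧ ∑ i, pi i = 1

/-- The partial sum `σ_k = π_0 + ⋯ + π_k`. -/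
noncomputable def partialSum {n : ℕ} (pi : Fin n → ℝ) (k : Fin n) : ℝ :=
  ∑ j ∈ Finset.Iic k, pi j

/-- The ratio `(∏_{ℓ=0}^{j-1} lam ℓ) / (∏_{ℓ=1}^{j} mu ℓ)`. -/
noncomputable def rateRatio (lam mu : ℕ → ℝ) (j : ℕ) : ℝ :=
  (∏ l ∈ Finset.Ico 0 j, lam l) / ∏ l ∈ Finset.Icc 1 j, mu l

/-
If `(I - P) G = I - 𝟏 qᵀ` and `G 𝟏 = 0`, then `I - P + 𝟏 vᵀ` has inverse `G + 𝟏 (q - Gᵀ v)ᵀ`, so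
`κ(P) = trace G` whatever `v` is, and `q` is the only stationary vector. For a birth-death chain
the distribution `q` proportional to the tree weights satisfies detailed balance, which turns
`q_i ((I - P) f)_i` into the difference of the flows `λ_k q_k (f_{k+1} - f_k)` through the two
edges at `i`. Prescribing these flows gives `G` explicitly: its column `j` carries
`q_j ∑_{l ≤ k} (q_l - δ_{lj})` through the edge `{k, k + 1}`, so that
`trace G = ∑_k ∑_{p < k} q_k σ_p / (λ_p q_p)`. Summing over `k` first gives the formula in `σ`; the
identity `t(j) t(k) = w(j,k,p) λ_p t(p)` gives the formula in forest weights.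
-/

section PoissonEquation

theorem vecMul_eq_self_of_detailedBalance {ι R : Type*} [Fintype ι] [NonAssocSemiring R]
    {P : Matrix ι ι R} {q : ι → R} (hP : P *ᵥ 1 = 1)
    (hq : ∀ i j, q i * P i j = q j * P j i) : q ᵥ* P = q := by
  ext j
  have hrow : ∑ i, P j i = 1 := by simpa [Matrix.mulVec, dotProduct] using congrFun hP j
  simp only [Matrix.vecMul, dotProduct, hq _ j, ← Finset.mul_sum, hrow, mul_one]

variable {ι R : Type*} [Fintype ι] [DecidableEq ι] [Ring R]
  {P G : Matrix ι ι R} {q v x : ι → R}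

theorem one_sub_add_vecMulVec_mul_eq_one (hP : P *ᵥ 1 = 1)
    (hG : (1 - P) * G = 1 - Matrix.vecMulVec 1 q) (hv : ∑ i, v i = 1) :
    (1 - P + Matrix.vecMulVec 1 v) * (G + Matrix.vecMulVec 1 (q - v ᵥ* G)) = 1 := by
  have hP0 : (1 - P) *ᵥ (1 : ι → R) = 0 := by
    rw [Matrix.sub_mulVec, Matrix.one_mulVec, hP, sub_self]
  rw [add_mul, mul_add, mul_add, hG, Matrix.mul_vecMulVec, hP0, Matrix.zero_vecMulVec,
    Matrix.vecMulVec_mul, Matrix.vecMulVec_mul_vecMulVec, dotProduct_one, hv, one_smul,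
    Matrix.vecMulVec_sub]
  abel

theorem sum_eq_one_of_one_sub_mul_eq (hG : (1 - P) * G = 1 - Matrix.vecMulVec 1 q)
    (hG1 : G *ᵥ 1 = 0) (hv : ∑ i, v i = 1) : ∑ i, q i = 1 := by
  have h : v ⬝ᵥ ((1 - P) * G) *ᵥ 1 = 0 := by
    rw [← Matrix.mulVec_mulVec, hG1, Matrix.mulVec_zero, dotProduct_zero]
  rw [hG, Matrix.sub_mulVec, Matrix.one_mulVec, Matrix.vecMulVec_mulVec, dotProduct_sub,
    dotProduct_smul, dotProduct_one, dotProduct_one, hv] at h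
  simpa using (sub_eq_zero.1 h).symm

theorem eq_of_vecMul_eq_self (hG : (1 - P) * G = 1 - Matrix.vecMulVec 1 q)
    (hx : x ᵥ* P = x) (hx1 : ∑ i, x i = 1) : x = q := by
  have h : x ᵥ* ((1 - P) * G) = 0 := by
    rw [← Matrix.vecMul_vecMul, Matrix.vecMul_sub, Matrix.vecMul_one, hx, sub_self,
      Matrix.zero_vecMul]
  rw [hG, Matrix.vecMul_sub, Matrix.vecMul_one, Matrix.vecMul_vecMulVec, dotProduct_one, hx1,
    one_smul] at h
  exact sub_eq_zero.1 h

theorem one_sub_mulVec_apply (hP : P *ᵥ 1 = 1) (f : ι → R) (i : ι) :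
    ((1 - P) *ᵥ f) i = ∑ j, P i j * (f i - f j) := by
  have hrow : ∑ j, P i j = 1 := by simpa [Matrix.mulVec, dotProduct] using congrFun hP i
  rw [Matrix.sub_mulVec, Matrix.one_mulVec, Pi.sub_apply]
  simp only [mul_sub, Finset.sum_sub_distrib, ← Finset.sum_mul, hrow, one_mul, Matrix.mulVec,
    dotProduct]

end PoissonEquation

section Kemeny

variable {n : ℕ} {P G : Matrix (Fin n) (Fin n) ℝ} {q v : Fin n → ℝ}

theorem isUnit_kemenyMatrix (hP : P *ᵥ 1 = 1)
    (hG : (1 - P) * G = 1 - Matrix.vecMulVec 1 q) (hv : ∑ i, v i = 1) :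
    IsUnit (kemenyMatrix P v) :=
  IsUnit.of_mul_eq_one _ (one_sub_add_vecMulVec_mul_eq_one hP hG hv)

theorem kemenyConstant_eq_trace (hP : P *ᵥ 1 = 1)
    (hG : (1 - P) * G = 1 - Matrix.vecMulVec 1 q) (hG1 : G *ᵥ 1 = 0) (hv : ∑ i, v i = 1) :
    kemenyConstant P v = G.trace := by
  have hvG : v ᵥ* G ⬝ᵥ 1 = 0 := by
    rw [← Matrix.dotProduct_mulVec, hG1, dotProduct_zero]
  rw [kemenyConstant, kemenyMatrix,
    Matrix.inv_eq_right_inv (one_sub_add_vecMulVec_mul_eq_one hP hG hv), Matrix.trace_add,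
    Matrix.trace_vecMulVec, dotProduct_comm, sub_dotProduct, hvG, dotProduct_one,
    sum_eq_one_of_one_sub_mul_eq hG hG1 hv]
  ring

end Kemeny

section Irreducible

theorem exists_pos_apply_of_isIrreducible {ι R : Type*} [Ring R] [LinearOrder R]
    {A : Matrix ι ι R} (hA : A.IsIrreducible) {S : Set ι} {i j : ι} (hi : i ∈ S) (hj : j ∉ S) :
    ∃ a ∈ S, ∃ b ∉ S, 0 < A a b := by
  let : Quiver ι := A.toQuiver
  obtain ⟨p, -⟩ := hA.connected i j
  obtain ⟨a, ha, b, hb, e, -⟩ := p.exists_mem_notMem_hom_path_path_of_notMem_mem S hi hj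
  exact ⟨a, ha, b, hb, e.down⟩

variable {n : ℕ} {theta lam mu : ℕ → ℝ}

theorem lam_pos_of_isIrreducible (h : (birthDeathMatrix n theta lam mu).IsIrreducible) {k : ℕ}
    (hk : k + 1 < n) : 0 < lam k := by
  obtain ⟨a, ha, b, hb, hab⟩ := exists_pos_apply_of_isIrreducible h
    (S := {i | (i : ℕ) ≤ k}) (i := ⟨k, by omega⟩) (j := ⟨k + 1, hk⟩) (by simp) (by simp)
  simp only [Set.mem_ofPred_eq, not_le] at ha hb
  simp only [birthDeathMatrix, Matrix.of_apply] at hab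
  grind

theorem mu_pos_of_isIrreducible (h : (birthDeathMatrix n theta lam mu).IsIrreducible) {k : ℕ}
    (hk0 : 1 ≤ k) (hk : k < n) : 0 < mu k := by
  obtain ⟨a, ha, b, hb, hab⟩ := exists_pos_apply_of_isIrreducible h
    (S := {i | k ≤ (i : ℕ)}) (i := ⟨k, hk⟩) (j := ⟨k - 1, by omega⟩) (by simp)
    (by simp only [Set.mem_ofPred_eq]; omega)
  simp only [Set.mem_ofPred_eq, not_le] at ha hb
  simp only [birthDeathMatrix, Matrix.of_apply] at hab
  grind

end Irreducible

section PotentialKernel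

/-- Detailed balance across every edge `{k, k + 1}` of the path `0, …, n - 1`, for birth rates
`lam`, death rates `mu` and weights `q`. -/
def IsReversing (n : ℕ) (lam mu q : ℕ → ℝ) : Prop :=
  ∀ k, k + 1 < n → lam k * q k = mu (k + 1) * q (k + 1)

/-- The solution `G`, with vanishing row `0`, of Poisson's equation `(I - P) G = I - 𝟏 qᵀ` for a
birth-death chain `P` with birth rates `lam` and reversing distribution `q`. -/
noncomputable def potentialKernel (n : ℕ) (lam q : ℕ → ℝ) : Matrix (Fin n) (Fin n) ℝ :=
  Matrix.of fun i j =>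
    ∑ k ∈ Finset.range i,
      q j * (∑ l ∈ Finset.range (k + 1), (q l - if l = j then 1 else 0)) / (lam k * q k)

variable {n : ℕ} {theta lam mu q : ℕ → ℝ}

theorem sum_birthDeathMatrix_mul (f : ℕ → ℝ) (i : Fin n) :
    ∑ j : Fin n, birthDeathMatrix n theta lam mu i j * f j =
      theta i * f i + (if (i : ℕ) + 1 < n then lam i * f (i + 1) else 0) +
        (if 1 ≤ (i : ℕ) then mu i * f (i - 1) else 0) := by
  obtain ⟨i, hi⟩ := i
  let row : ℕ → ℝ := fun j =>
    if j = i then theta i else if j = i + 1 then lam i else if i = j + 1 then mu i else 0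
  have hrow : ∀ j, row j * f j =
      (if j = i then theta i * f i else 0) + (if j = i + 1 then lam i * f (i + 1) else 0) +
        (if j = i - 1 then (if 1 ≤ i then mu i * f (i - 1) else 0) else 0) := by
    rcases i with _ | i <;> grind
  have hpred : i - 1 < n := by omega
  refine (Fin.sum_univ_eq_sum_range (fun j => row j * f j) n).trans ?_
  simp only [hrow, Finset.sum_add_distrib, Finset.sum_ite_eq', Finset.mem_range, hi, hpred,
    if_true]

theorem IsReversing.vecMul_birthDeathMatrix (hq : IsReversing n lam mu q)
    (hP : birthDeathMatrix n theta lam mu *ᵥ 1 = 1) :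
    (fun j : Fin n => q j) ᵥ* birthDeathMatrix n theta lam mu = fun j : Fin n => q j := by
  refine vecMul_eq_self_of_detailedBalance hP fun ⟨i, hi⟩ ⟨j, hj⟩ => ?_
  simp only [birthDeathMatrix, Matrix.of_apply]
  have := hq i
  have := hq j
  grind

theorem IsReversing.mul_one_sub_birthDeathMatrix_mulVec (hq : IsReversing n lam mu q)
    (hP : birthDeathMatrix n theta lam mu *ᵥ 1 = 1) {f s : ℕ → ℝ} (hs0 : s 0 = 0)
    (hsn : s n = 0) (hs : ∀ k, k + 1 < n → lam k * q k * (f (k + 1) - f k) = s (k + 1))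
    (i : Fin n) :
    q i * ((1 - birthDeathMatrix n theta lam mu) *ᵥ fun j : Fin n => f j) i = s i - s (i + 1) := by
  rw [one_sub_mulVec_apply hP, sum_birthDeathMatrix_mul (fun j => f i - f j)]
  obtain ⟨i, hi⟩ := i
  have birth : q i * (if i + 1 < n then lam i * (f i - f (i + 1)) else 0) = -s (i + 1) := by
    split_ifs with h
    · rw [← hs i h]
      ring
    · rw [show i + 1 = n by omega, hsn, mul_zero, neg_zero]
  have death : q i * (if 1 ≤ i then mu i * (f i - f (i - 1)) else 0) = s i := by
    rcases i with _ | i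
    · simp [hs0]
    · rw [if_pos (by omega), Nat.add_sub_cancel, ← hs i hi, hq i hi]
      ring
  linear_combination birth + death

theorem IsReversing.one_sub_birthDeathMatrix_mul_potentialKernel
    (hq : IsReversing n lam mu q) (hP : birthDeathMatrix n theta lam mu *ᵥ 1 = 1)
    (hlam : ∀ k, k + 1 < n → lam k ≠ 0) (hq0 : ∀ k, k < n → q k ≠ 0)
    (hq1 : ∑ l ∈ Finset.range n, q l = 1) :
    (1 - birthDeathMatrix n theta lam mu) * potentialKernel n lam q =
      1 - Matrix.vecMulVec 1 (fun j : Fin n => q j) := by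
  ext i j
  let s : ℕ → ℝ := fun m => q j * ∑ l ∈ Finset.range m, (q l - if l = j then 1 else 0)
  let f : ℕ → ℝ := fun i => ∑ k ∈ Finset.range i, s (k + 1) / (lam k * q k)
  have hsn : s n = 0 := by simp [s, hq1]
  have hf : ∀ k, k + 1 < n → lam k * q k * (f (k + 1) - f k) = s (k + 1) := fun k hk => by
    have := hlam k hk
    have := hq0 k (by omega)
    simp only [f, Finset.sum_range_succ, add_sub_cancel_left]
    field_simp
  have hs_succ : s i - s (i + 1) = q j * ((if (i : ℕ) = j then 1 else 0) - q i) := by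
    simp only [s, Finset.sum_range_succ]
    ring
  have hflow := hq.mul_one_sub_birthDeathMatrix_mulVec hP (by simp [s]) hsn hf i
  refine mul_left_cancel₀ (hq0 i i.2) (hflow.trans ?_)
  rw [hs_succ, Matrix.sub_apply, Matrix.one_apply, Matrix.vecMulVec_apply, Pi.one_apply, one_mul]
  rcases eq_or_ne i j with rfl | hij
  · simp
  · simp only [Fin.val_ne_iff.2 hij, hij, if_false]
    ring

theorem potentialKernel_mulVec_one (hq1 : ∑ l ∈ Finset.range n, q l = 1) :
    potentialKernel n lam q *ᵥ 1 = 0 := by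
  ext i
  rw [Matrix.mulVec, dotProduct_one]
  simp only [potentialKernel, Matrix.of_apply, Pi.zero_apply]
  rw [Finset.sum_comm]
  refine Finset.sum_eq_zero fun k hk => ?_
  have hkn : k + 1 ≤ n := (Finset.mem_range.1 hk).trans_le i.2.le
  simp only [Finset.mul_sum]
  rw [← Finset.sum_div, Finset.sum_comm, Finset.sum_eq_zero, zero_div]
  intro l hl
  have hln : l < n := (Finset.mem_range.1 hl).trans_le hkn
  rw [Fin.sum_univ_eq_sum_range (fun j => q j * (q l - if l = j then 1 else 0))]
  simp [mul_sub, Finset.sum_sub_distrib, ← Finset.sum_mul, hq1, hln]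

theorem trace_potentialKernel (lam q : ℕ → ℝ) :
    (potentialKernel n lam q).trace =
      ∑ k ∈ Finset.range n, ∑ p ∈ Finset.range k,
        q k * (∑ l ∈ Finset.range (p + 1), q l) / (lam p * q p) := by
  simp only [Matrix.trace, Matrix.diag_apply, potentialKernel, Matrix.of_apply]
  rw [Fin.sum_univ_eq_sum_range (fun k => ∑ p ∈ Finset.range k,
    q k * (∑ l ∈ Finset.range (p + 1), (q l - if l = k then 1 else 0)) / (lam p * q p)) n]
  refine Finset.sum_congr rfl fun k _ => Finset.sum_congr rfl fun p hp => ?_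
  have hpk : ¬ k < p + 1 := by simpa [Nat.lt_succ_iff] using hp
  simp [Finset.sum_sub_distrib, hpk]

theorem partialSum_eq_sum_range (q : ℕ → ℝ) (k : Fin n) :
    partialSum (fun j : Fin n => q j) k = ∑ l ∈ Finset.range (k + 1), q l := by
  rw [partialSum, Nat.range_succ_eq_Iic, ← Fin.map_valEmbedding_Iic, Finset.sum_map]
  rfl

theorem trace_potentialKernel_eq_sum_partialSum (hq1 : ∑ l ∈ Finset.range n, q l = 1) :
    (potentialKernel n lam q).trace =
      ∑ k ∈ Finset.univ.filter (fun k : Fin n => (k : ℕ) + 1 < n),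
        partialSum (fun j : Fin n => q j) k * (1 - partialSum (fun j : Fin n => q j) k) /
          (lam k * q k) := by
  let σ : ℕ → ℝ := fun k => ∑ l ∈ Finset.range (k + 1), q l
  have htail : ∀ p, p < n → ∑ k ∈ Finset.Ico (p + 1) n, q k = 1 - σ p := fun p hp => by
    rw [← hq1, ← Finset.sum_range_add_sum_Ico q (Nat.succ_le_of_lt hp), add_sub_cancel_left]
  have hlast : ∀ k : Fin n, σ k * (1 - σ k) / (lam k * q k) ≠ 0 → (k : ℕ) + 1 < n := by
    intro k hk
    by_contra h
    have hkn : (k : ℕ) + 1 = n := by omega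
    simp [σ, hkn, hq1] at hk
  simp only [partialSum_eq_sum_range]
  rw [Finset.sum_filter_of_ne fun k _ => hlast k,
    Fin.sum_univ_eq_sum_range (fun k => σ k * (1 - σ k) / (lam k * q k)) n,
    trace_potentialKernel]
  simp only [Finset.range_eq_Ico]
  rw [← Finset.sum_Ico_Ico_comm']
  refine Finset.sum_congr rfl fun p hp => ?_
  rw [← Finset.sum_div, ← Finset.sum_mul, htail p (Finset.mem_Ico.1 hp).2, ← Finset.range_eq_Ico,
    mul_comm]

end PotentialKernel

section TreeDistribution

/-- The tree weights `t(k)` normalized to total mass one: the stationary distribution of the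
birth-death chain. -/
noncomputable def treeDistribution (n : ℕ) (lam mu : ℕ → ℝ) (k : ℕ) : ℝ :=
  treeWeight n lam mu k / ∑ l ∈ Finset.range n, treeWeight n lam mu l

variable {n : ℕ} {theta lam mu : ℕ → ℝ}

theorem treeWeight_pos (hlam : ∀ k, k + 1 < n → 0 < lam k)
    (hmu : ∀ k, 1 ≤ k → k < n → 0 < mu k) {k : ℕ} (hk : k < n) :
    0 < treeWeight n lam mu k := by
  refine mul_pos (Finset.prod_pos fun l hl => hlam l ?_) (Finset.prod_pos fun l hl => hmu l ?_ ?_)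
  all_goals rw [Finset.mem_Ico] at hl; omega

theorem sum_treeWeight_pos (hn : 1 ≤ n) (hlam : ∀ k, k + 1 < n → 0 < lam k)
    (hmu : ∀ k, 1 ≤ k → k < n → 0 < mu k) : 0 < ∑ k ∈ Finset.range n, treeWeight n lam mu k :=
  Finset.sum_pos (fun _ hk => treeWeight_pos hlam hmu (Finset.mem_range.1 hk))
    (Finset.nonempty_range_iff.2 (Nat.one_le_iff_ne_zero.1 hn))

theorem isReversing_treeDistribution : IsReversing n lam mu (treeDistribution n lam mu) := by
  intro k hk
  rw [treeDistribution, treeDistribution, treeWeight, treeWeight,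
    Finset.prod_Ico_succ_top (Nat.zero_le k), Finset.prod_eq_prod_Ico_succ_bot hk]
  ring

theorem sum_treeDistribution (hT : ∑ k ∈ Finset.range n, treeWeight n lam mu k ≠ 0) :
    ∑ k ∈ Finset.range n, treeDistribution n lam mu k = 1 := by
  simp only [treeDistribution, ← Finset.sum_div, div_self hT]

theorem isStationaryVector_treeDistribution (hP : birthDeathMatrix n theta lam mu *ᵥ 1 = 1)
    (hT : ∑ k ∈ Finset.range n, treeWeight n lam mu k ≠ 0) :
    IsStationaryVector (birthDeathMatrix n theta lam mu)
      (fun j : Fin n => treeDistribution n lam mu j) :=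
  ⟨isReversing_treeDistribution.vecMul_birthDeathMatrix hP,
    (Fin.sum_univ_eq_sum_range _ n).trans (sum_treeDistribution hT)⟩

theorem prod_Icc_mul_prod_Ico {M : Type*} [CommMonoid M] (f : ℕ → M) {a b c : ℕ}
    (hab : a ≤ b + 1) (hbc : b < c) :
    (∏ l ∈ Finset.Icc a b, f l) * ∏ l ∈ Finset.Ico (b + 1) c, f l = ∏ l ∈ Finset.Ico a c, f l := by
  rw [← Finset.Ico_add_one_right_eq_Icc]
  exact Finset.prod_Ico_consecutive f hab hbc

theorem treeWeight_mul_treeWeight {j k p : ℕ} (hjp : j ≤ p) (hpk : p < k) (hp : p < n) :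
    treeWeight n lam mu j * treeWeight n lam mu k =
      forestWeight n lam mu j k p * (lam p * treeWeight n lam mu p) := by
  have births : ∏ l ∈ Finset.Ico 0 k, lam l =
      (∏ l ∈ Finset.Ico 0 p, lam l) * lam p * ∏ l ∈ Finset.Ico (p + 1) k, lam l := by
    rw [← Finset.prod_Ico_succ_top (Nat.zero_le p), Finset.prod_Ico_consecutive _ (by omega) hpk]
  have deaths : ∏ l ∈ Finset.Ico (j + 1) n, mu l =
      (∏ l ∈ Finset.Icc (j + 1) p, mu l) * ∏ l ∈ Finset.Ico (p + 1) n, mu l :=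
    (prod_Icc_mul_prod_Ico mu (by omega) hp).symm
  simp only [treeWeight, forestWeight, births, deaths]
  ring

theorem treeDistribution_mul_div {j k p : ℕ} (hjp : j ≤ p) (hpk : p < k) (hp : p < n)
    (hlam : lam p ≠ 0) (ht : treeWeight n lam mu p ≠ 0)
    (hT : ∑ l ∈ Finset.range n, treeWeight n lam mu l ≠ 0) :
    treeDistribution n lam mu k * treeDistribution n lam mu j /
        (lam p * treeDistribution n lam mu p) =
      forestWeight n lam mu j k p / ∑ l ∈ Finset.range n, treeWeight n lam mu l := by
  simp only [treeDistribution]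
  field_simp
  linear_combination treeWeight_mul_treeWeight (lam := lam) (mu := mu) hjp hpk hp

theorem trace_potentialKernel_treeDistribution
    (hlam : ∀ k, k + 1 < n → lam k ≠ 0) (ht : ∀ k, k + 1 < n → treeWeight n lam mu k ≠ 0)
    (hT : ∑ k ∈ Finset.range n, treeWeight n lam mu k ≠ 0) :
    (potentialKernel n lam (treeDistribution n lam mu)).trace =
      (∑ k ∈ Finset.range n, ∑ j ∈ Finset.range k, ∑ p ∈ Finset.Ico j k,
        forestWeight n lam mu j k p) / ∑ k ∈ Finset.range n, treeWeight n lam mu k := by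
  rw [trace_potentialKernel, Finset.sum_div]
  refine Finset.sum_congr rfl fun k hk => ?_
  have hswap : ∑ j ∈ Finset.range k, ∑ p ∈ Finset.Ico j k, forestWeight n lam mu j k p =
      ∑ p ∈ Finset.range k, ∑ j ∈ Finset.range (p + 1), forestWeight n lam mu j k p := by
    simpa only [Finset.range_eq_Ico] using
      Finset.sum_Ico_Ico_comm 0 k fun j p => forestWeight n lam mu j k p
  simp only [hswap, Finset.mul_sum, Finset.sum_div]
  refine Finset.sum_congr rfl fun p hp => Finset.sum_congr rfl fun j hj => ?_
  rw [Finset.mem_range] at hk hp hj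
  exact treeDistribution_mul_div (by omega) hp (by omega) (hlam p (by omega)) (ht p (by omega)) hT

theorem treeWeight_eq_mul_rateRatio (hmu : ∀ k, 1 ≤ k → k < n → mu k ≠ 0) {j : ℕ} (hj : j < n) :
    treeWeight n lam mu j = treeWeight n lam mu 0 * rateRatio lam mu j := by
  have deaths : ∏ l ∈ Finset.Ico 1 n, mu l =
      (∏ l ∈ Finset.Icc 1 j, mu l) * ∏ l ∈ Finset.Ico (j + 1) n, mu l :=
    (prod_Icc_mul_prod_Ico mu (by omega) hj).symm
  have hdeaths : ∏ l ∈ Finset.Icc 1 j, mu l ≠ 0 := Finset.prod_ne_zero_iff.2 fun l hl =>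
    hmu l (Finset.mem_Icc.1 hl).1 ((Finset.mem_Icc.1 hl).2.trans_lt hj)
  rw [treeWeight, treeWeight, rateRatio, zero_add, deaths, Finset.Ico_self, Finset.prod_empty]
  field_simp

theorem treeDistribution_eq_mul_rateRatio (hmu : ∀ k, 1 ≤ k → k < n → mu k ≠ 0) {j : ℕ}
    (hj : j < n) :
    treeDistribution n lam mu j = treeDistribution n lam mu 0 * rateRatio lam mu j := by
  rw [treeDistribution, treeDistribution, treeWeight_eq_mul_rateRatio hmu hj, mul_div_right_comm]

theorem treeDistribution_zero (hmu : ∀ k, 1 ≤ k → k < n → mu k ≠ 0)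
    (hT : ∑ k ∈ Finset.range n, treeWeight n lam mu k ≠ 0) :
    treeDistribution n lam mu 0 = (∑ j ∈ Finset.range n, rateRatio lam mu j)⁻¹ := by
  refine eq_inv_of_mul_eq_one_left ?_
  rw [Finset.mul_sum, ← sum_treeDistribution hT]
  exact Finset.sum_congr rfl fun j hj =>
    (treeDistribution_eq_mul_rateRatio hmu (Finset.mem_range.1 hj)).symm

end TreeDistribution

theorem mainTheorem7_general (n : ℕ) (hn : 1 ≤ n) (theta lam mu : ℕ → ℝ)
    (hP : birthDeathMatrix n theta lam mu *ᵥ 1 = 1)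
    (hlam : ∀ k, k + 1 < n → 0 < lam k) (hmu : ∀ k, 1 ≤ k → k < n → 0 < mu k) :
    (∀ v : Fin n → ℝ, ∑ i, v i = 1 →
      IsUnit (kemenyMatrix (birthDeathMatrix n theta lam mu) v) ∧
      kemenyConstant (birthDeathMatrix n theta lam mu) v =
        (∑ k ∈ Finset.range n, ∑ j ∈ Finset.range k, ∑ p ∈ Finset.Ico j k,
            forestWeight n lam mu j k p) /
          ∑ k ∈ Finset.range n, treeWeight n lam mu k) ∧
    0 < ∑ k ∈ Finset.range n, treeWeight n lam mu k ∧
    (∃! pi : Fin n → ℝ, IsStationaryVector (birthDeathMatrix n theta lam mu) pi) ∧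
    (∀ pi : Fin n → ℝ, IsStationaryVector (birthDeathMatrix n theta lam mu) pi →
      (∀ i, 0 < pi i) ∧
      (∀ v : Fin n → ℝ, ∑ i, v i = 1 →
        kemenyConstant (birthDeathMatrix n theta lam mu) v =
          ∑ k ∈ Finset.univ.filter (fun k : Fin n => (k : ℕ) + 1 < n),
            partialSum pi k * (1 - partialSum pi k) / (lam k * pi k)) ∧
      pi ⟨0, hn⟩ = (∑ j ∈ Finset.range n, rateRatio lam mu j)⁻¹ ∧
      (∀ j : Fin n, 1 ≤ (j : ℕ) → pi j = pi ⟨0, hn⟩ * rateRatio lam mu j)) := by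
  have hT := sum_treeWeight_pos hn hlam hmu
  have hq : ∀ k, k < n → 0 < treeDistribution n lam mu k := fun k hk =>
    div_pos (treeWeight_pos hlam hmu hk) hT
  have hlam0 : ∀ k, k + 1 < n → lam k ≠ 0 := fun k hk => (hlam k hk).ne'
  have hmu0 : ∀ k, 1 ≤ k → k < n → mu k ≠ 0 := fun k hk hkn => (hmu k hk hkn).ne'
  have hq1 := sum_treeDistribution hT.ne'
  have hG := isReversing_treeDistribution.one_sub_birthDeathMatrix_mul_potentialKernel hP hlam0
    (fun k hk => (hq k hk).ne') hq1
  have hκ := fun v hv => kemenyConstant_eq_trace (v := v) hP hG (potentialKernel_mulVec_one hq1) hv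
  refine ⟨fun v hv => ⟨isUnit_kemenyMatrix hP hG hv, (hκ v hv).trans ?_⟩, hT,
    ⟨_, isStationaryVector_treeDistribution hP hT.ne', fun x hx =>
      eq_of_vecMul_eq_self hG hx.1 hx.2⟩, fun x hx => ?_⟩
  · exact trace_potentialKernel_treeDistribution hlam0
      (fun k hk => (treeWeight_pos hlam hmu (Nat.lt_of_succ_lt hk)).ne') hT.ne'
  · obtain rfl := eq_of_vecMul_eq_self hG hx.1 hx.2
    exact ⟨fun i => hq i i.2,
      fun v hv => (hκ v hv).trans (trace_potentialKernel_eq_sum_partialSum hq1),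
      treeDistribution_zero hmu0 hT.ne', fun j _ => treeDistribution_eq_mul_rateRatio hmu0 j.2⟩

theorem mainTheorem7 (n : ℕ) (hn : 1 ≤ n) (theta lam mu : ℕ → ℝ)
    (P : Matrix (Fin n) (Fin n) ℝ) (hP : P = birthDeathMatrix n theta lam mu)
    (hstoch : P ∈ Matrix.rowStochastic ℝ (Fin n)) (hirr : P.IsIrreducible) :
    (∀ v : Fin n → ℝ, ∑ i, v i = 1 →
      IsUnit (kemenyMatrix P v) ∧
      kemenyConstant P v =
        (∑ k ∈ Finset.range n, ∑ j ∈ Finset.range k, ∑ p ∈ Finset.Ico j k,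
            forestWeight n lam mu j k p) /
          ∑ k ∈ Finset.range n, treeWeight n lam mu k) ∧
    0 < ∑ k ∈ Finset.range n, treeWeight n lam mu k ∧
    (∃! pi : Fin n → ℝ, IsStationaryVector P pi) ∧
    (∀ pi : Fin n → ℝ, IsStationaryVector P pi →
      (∀ i, 0 < pi i) ∧
      (∀ v : Fin n → ℝ, ∑ i, v i = 1 →
        kemenyConstant P v =
          ∑ k ∈ Finset.univ.filter (fun k : Fin n => (k : ℕ) + 1 < n),
            partialSum pi k * (1 - partialSum pi k) / (lam k * pi k)) ∧
      pi ⟨0, hn⟩ = (∑ j ∈ Finset.range n, rateRatio lam mu j)⁻¹ ∧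
      (∀ j : Fin n, 1 ≤ (j : ℕ) → pi j = pi ⟨0, hn⟩ * rateRatio lam mu j)) := by
  subst hP
  exact mainTheorem7_general n hn theta lam mu hstoch.2
    (fun _ => lam_pos_of_isIrreducible hirr) (fun _ => mu_pos_of_isIrreducible hirr)
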